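/- Let $\mathcal C$ be a small non-empty category, let $\mathcal C\hookrightarrow\mathcal D$ be a full embedding into a (locally small) category $\mathcal D$, and let $u$ be an object of $\mathcal D$ which is - $\mathcal C$-universal: every object $c$ of $\mathcal C$ admits an arrow $c\to u$ in $\mathcal D$; and - $\mathcal C$-ultrahomogeneous: for every arrow $j:a\to b$ of $\mathcal C$ and all arrows $\chi_1:a\to u$, $\chi_2:b\to u$ in $\mathcal D$ there is an automorphism $i$ of $u$ in $\mathcal D$ with $i\circ\chi_1=\chi_2\circ j$. Suppose moreover that (a) for all objects $a,b$ of $\mathcal C$ and arrows $\xi:a\to u$, $\chi:b\to u$ in $\mathcal D$ there are an object $c$ of $\mathcal C$, arrows $f:a\to c$, $g:b\to c$ in $\mathcal C$ and an arrow $\varepsilon:c\to u$ in $\mathcal D$ such that $\varepsilon\circ f=\xi$ and $\varepsilon\circ g=\chi$; (b) for all arrows $f,g:a\to b$ in $\mathcal C$ and every arrow $\chi:b\to u$ in $\mathcal D$, $\chi\circ f=\chi\circ g$ implies $f=g$. Then: 1. $\mathcal C$ satisfies the amalgamation property (for all arrows $f:a\to b$, $g:a\to c$ of $\mathcal C$ there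 are arrows $f':b\to d$, $g':c\to d$ of $\mathcal C$ with $f'\circ f=g'\circ g$) and the joint embedding property (any two objects of $\mathcal C$ admit arrows in $\mathcal C$ to a common object). 2. The subgroups $\mathcal I_\chi=\{f\in \mathrm{Aut}_{\mathcal D}(u) : f\circ\chi=\chi\}$, for arrows $\chi:c\to u$ from objects $c$ of $\mathcal C$, form an algebraic base for $\mathrm{Aut}_{\mathcal D}(u)$: with the topology generated by their left cosets, $\mathrm{Aut}_{\mathcal D}(u)$ is a topological group in which they form a basis of neighbourhoods of the identity, the intersection of any two of them contains a third, and every conjugate of one of them is again one of them. 3. For this topology, there is a functor $F:\mathcal C^{\mathrm{op}}\to \mathbf{Cont}(\mathrm{Aut}_{\mathcal D}(u))$ to the category of sets with a continuous left action of $\mathrm{Aut}_{\mathcal D}(u)$ (the sets being discrete) and equivariant maps, which sends an object $c$ to $\mathrm{Hom}_{\mathcal D}(c,u)$ with the action by composition, and an arrow $f:d\to c$ to $-\circ f:\mathrm{Hom}_{\mathcal D}(c,u)\to\mathrm{Hom}_{\mathcal D}(d,u)$; all its values are non-empty transitive actions. 4. The following conditions are equivalent: (i) every arrow $f:d\to c$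 of $\mathcal C$ is a strict monomorphism, i.e. every arrow $g:e\to c$ of $\mathcal C$, such that $h\circ g=k\circ g$ for all $h,k:c\to z$ in $\mathcal C$ with $h\circ f=k\circ f$, factors uniquely through $f$; (ii) $F$ is full and faithful and induces an equivalence $\mathbf{Sh}(\mathcal C^{\mathrm{op}},J_{at})\simeq\mathbf{Cont}(\mathrm{Aut}_{\mathcal D}(u))$, where $J_{at}$ is the atomic topology (its covering sieves are the non-empty ones); that is, there is such an equivalence whose composite with the canonical functor $\mathcal C^{\mathrm{op}}\to\mathbf{Sh}(\mathcal C^{\mathrm{op}},J_{at})$ (the Yoneda embedding followed by the associated sheaf functor) is isomorphic to $F$. -/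

import Mathlib

open CategoryTheory Opposite

universe v w

namespace GaloisTopos

section Categories

variable {C : Type*} [Category C] {D : Type*} [Category D]

/-- The amalgamation property: every pair of arrows with common domain can be completed to a
commutative square. -/
def AmalgamationProperty (C : Type*) [Category C] : Prop :=
  ∀ ⦃a b c : C⦄ (f : a ⟶ b) (g : a ⟶ c), ∃ (d : C) (f' : b ⟶ d) (g' : c ⟶ d), f ≫ f' = g ≫ g'

/-- The joint embedding property: any two objects admit arrows to a common object. -/
def JointEmbeddingProperty (C : Type*) [Category C] : Prop :=
  ∀ a b : C, ∃ c : C, Nonempty (a ⟶ c) ∧ Nonempty (b ⟶ c)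

/-- `f : d ⟶ c` is a strict monomorphism if every arrow `g : e ⟶ c`, such that `h ∘ g = k ∘ g`
whenever `h ∘ f = k ∘ f`, factors uniquely through `f`. -/
def IsStrictMonomorphism {d c : C} (f : d ⟶ c) : Prop :=
  ∀ ⦃e : C⦄ (g : e ⟶ c), (∀ ⦃z : C⦄ (h k : c ⟶ z), f ≫ h = f ≫ k → g ≫ h = g ≫ k) →
    ∃! l : e ⟶ d, l ≫ f = g

/-- `u` is `C`-universal: every object of `C` admits an arrow to `u` in `D`. -/
def IsUniversalObject (ι : C ⥤ D) (u : D) : Prop :=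
  ∀ a : C, Nonempty (ι.obj a ⟶ u)

/-- `u` is `C`-ultrahomogeneous: for every `j : a ⟶ b` in `C` and all arrows `χ₁ : a ⟶ u`,
`χ₂ : b ⟶ u` in `D` there is an automorphism `i` of `u` with `i ∘ χ₁ = χ₂ ∘ j`. -/
def IsUltrahomogeneous (ι : C ⥤ D) (u : D) : Prop :=
  ∀ ⦃a b : C⦄ (j : a ⟶ b) (χ₁ : ι.obj a ⟶ u) (χ₂ : ι.obj b ⟶ u),
    ∃ i : u ≅ u, χ₁ ≫ i.hom = ι.map j ≫ χ₂

/-- Any two arrows to `u` from objects of `C` factor, through arrows of `C`, through a common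
arrow to `u` from an object of `C`. -/
def HasJointFactorization (ι : C ⥤ D) (u : D) : Prop :=
  ∀ ⦃a b : C⦄ (ξ : ι.obj a ⟶ u) (χ : ι.obj b ⟶ u),
    ∃ (c : C) (f : a ⟶ c) (g : b ⟶ c) (ε : ι.obj c ⟶ u), ι.map f ≫ ε = ξ ∧ ι.map g ≫ ε = χ

/-- Arrows to `u` from objects of `C` can be cancelled against parallel pairs of arrows of `C`. -/
def IsMonicOverSource (ι : C ⥤ D) (u : D) : Prop :=
  ∀ ⦃a b : C⦄ (f g : a ⟶ b) (χ : ι.obj b ⟶ u), ι.map f ≫ χ = ι.map g ≫ χ → f = g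

theorem AmalgamationProperty.rightOre (h : AmalgamationProperty C) :
    GrothendieckTopology.RightOreCondition Cᵒᵖ := by
  intro X Y Z f g
  obtain ⟨d, f', g', e⟩ := h f.unop g.unop
  exact ⟨op d, f'.op, g'.op, Quiver.Hom.unop_inj e⟩

/-- The atomic topology on `Cᵒᵖ`: the covering sieves are exactly the nonempty ones. -/
def atomicTopology (h : AmalgamationProperty C) : GrothendieckTopology Cᵒᵖ :=
  GrothendieckTopology.atomic h.rightOre

end Categories

section TopologicalGroups

variable {G : Type*} [Group G]

/-- The topology on `G` generated by a collection `B` of subgroups: it is generated by the left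
cosets `g U` with `U ∈ B`. -/
abbrev topologyGeneratedBy (B : Set (Subgroup G)) : TopologicalSpace G :=
  TopologicalSpace.generateFrom {S | ∃ U ∈ B, ∃ g : G, S = {x | g⁻¹ * x ∈ U}}

/-- `B` is an algebraic base for the group `G` with the topology `τ`: this is a topological group,
`B` is a basis of neighbourhoods of the identity consisting of subgroups, the intersection
of two members of `B` contains a member of `B`, and `B` is closed under conjugation. -/
structure IsAlgebraicBase (τ : TopologicalSpace G) (B : Set (Subgroup G)) : Prop where
  isTopologicalGroup : @IsTopologicalGroup G τ _
  hasBasis : (@nhds G τ 1).HasBasis (fun U : Subgroup G => U ∈ B) (fun U => (U : Set G))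
  inter : ∀ U ∈ B, ∀ V ∈ B, ∃ W ∈ B, W ≤ U ⊓ V
  conj : ∀ U ∈ B, ∀ g : G, U.map (MulAut.conj g).toMonoidHom ∈ B

end TopologicalGroups

section ContinuousActions

/-- A left action of the group `G`, with topology `τ`, on a set, which is continuous when the set
is given the discrete topology. -/
structure ContSet (G : Type v) [Group G] (τ : TopologicalSpace G) where
  carrier : Type v
  [action : MulAction G carrier]
  continuous_action : @ContinuousSMul G carrier _ τ ⊥

attribute [instance] ContSet.action

variable {G : Type v} [Group G] {τ : TopologicalSpace G}

/-- The category `Cont(G)` of continuous `G`-sets and `G`-equivariant maps. -/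
instance : Category.{v} (ContSet G τ) where
  Hom X Y := X.carrier →[G] Y.carrier
  id X := MulActionHom.id G
  comp f g := MulActionHom.comp g f

/-- The nonempty transitive continuous actions. -/
def ContSet.IsTransitive (X : ContSet G τ) : Prop :=
  Nonempty X.carrier ∧ MulAction.IsPretransitive G X.carrier

end ContinuousActions

section Automorphisms

variable {C : Type*} [Category C] {D : Type w} [Category.{v} D]

/-- The action of `Aut u` on arrows to `u`, by composition. -/
instance homAction (x u : D) : MulAction (Aut u) (x ⟶ u) where
  smul g χ := χ ≫ g.hom
  one_smul χ := Category.comp_id χ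
  mul_smul g h χ := (Category.assoc χ h.hom g.hom).symm

theorem smul_def {x u : D} (g : Aut u) (χ : x ⟶ u) : g • χ = χ ≫ g.hom := rfl

/-- The subgroup `I_χ` of the automorphisms of `u` that fix the arrow `χ` to `u`. -/
def fixer {x u : D} (χ : x ⟶ u) : Subgroup (Aut u) where
  carrier := {f | χ ≫ f.hom = χ}
  one_mem' := Category.comp_id χ
  mul_mem' {f g} hf hg := by
    change χ ≫ g.hom ≫ f.hom = χ
    rw [← Category.assoc, hg, hf]
  inv_mem' {f} hf := by
    exact (Iso.comp_inv_eq (α := (f : u ≅ u))).2 (Eq.symm hf)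

/-- The collection of the subgroups `I_χ`, for the arrows `χ` from objects of `C` to `u`. -/
def fixers (ι : C ⥤ D) (u : D) : Set (Subgroup (Aut u)) :=
  {U | ∃ (c : C) (χ : ι.obj c ⟶ u), U = fixer χ}

/-- The topology on `Aut u` generated by the subgroups `I_χ`. -/
abbrev autTopology (ι : C ⥤ D) (u : D) : TopologicalSpace (Aut u) :=
  topologyGeneratedBy (fixers ι u)

theorem continuous_homAction (ι : C ⥤ D) (u : D) (c : C) :
    @ContinuousSMul (Aut u) (ι.obj c ⟶ u) _ (autTopology ι u) ⊥ := by
  let _ := autTopology ι u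
  let _ : TopologicalSpace (ι.obj c ⟶ u) := ⊥
  have _ : DiscreteTopology (ι.obj c ⟶ u) := ⟨rfl⟩
  refine ⟨continuous_prod_of_discrete_right.2 fun χ => ?_⟩
  refine continuous_discrete_rng.2 fun ψ => ?_
  by_cases h : ∃ g : Aut u, g • χ = ψ
  · obtain ⟨g, rfl⟩ := h
    refine TopologicalSpace.isOpen_generateFrom_of_mem ⟨fixer χ, ⟨c, χ, rfl⟩, g, ?_⟩
    ext x
    change x • χ = g • χ ↔ (g⁻¹ * x) • χ = χ
    rw [mul_smul, inv_smul_eq_iff]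
  · convert! isOpen_empty
    ext x
    simpa using fun hx => h ⟨x, hx⟩

/-- The functor `F : Cᵒᵖ ⥤ Cont(Aut u)` which sends `c` to `Hom(c, u)`, with the action of `Aut u`
by composition, and an arrow `f : d ⟶ c` of `C` to the map `- ∘ f : Hom(c, u) → Hom(d, u)`. -/
def homFunctor (ι : C ⥤ D) (u : D) : Cᵒᵖ ⥤ ContSet (Aut u) (autTopology ι u) where
  obj c := { carrier := ι.obj c.unop ⟶ u, continuous_action := continuous_homAction ι u c.unop }
  map {c d} f :=
    { toFun := fun χ : ι.obj c.unop ⟶ u => ι.map f.unop ≫ χ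
      map_smul' := fun g χ => (Category.assoc (ι.map f.unop) χ g.hom).symm }
  map_id c := by
    apply MulActionHom.ext
    intro χ
    change ι.map (𝟙 c.unop) ≫ χ = χ
    simp
  map_comp {c d e} f g := by
    apply MulActionHom.ext
    intro χ
    change ι.map (g.unop ≫ f.unop) ≫ χ = ι.map g.unop ≫ ι.map f.unop ≫ χ
    simp

end Automorphisms

/-- A functor `F : S ⥤ E` on a small site `(S, J)` induces an equivalence `Sh(S, J) ≃ E` if there
is an equivalence whose composite with the canonical functor `S ⥤ Sh(S, J)`, the Yoneda embedding
followed by the associated sheaf functor, is `F` up to isomorphism. -/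
def InducesEquivalence {S : Type v} [SmallCategory S] (J : GrothendieckTopology S)
    {E : Type*} [Category.{v} E] (F : S ⥤ E) : Prop :=
  ∃ Φ : Sheaf J (Type v) ≌ E,
    Nonempty ((yoneda ⋙ presheafToSheaf J (Type v)) ⋙ Φ.functor ≅ F)

end GaloisTopos

/-! Write `G` for `Aut u`. Universality and ultrahomogeneity make each `Hom(c, u)` a non-empty
transitive `G`-set, so a copy of `G / I_χ`; an equivariant map out of it is a point fixed by `I_χ`.
Joint factorization and cancellation make the arrows to `u` a directed system, whence the algebraic
base.

A continuous `G`-set `X` is therefore recovered from its sections `c ↦ Hom(F c, X)`. These form an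
atomic sheaf because every `- ∘ f` is a quotient map (`existsUnique_map_comp_eq`). Taking stalks at
`u` inverts this construction (`isIso_toSections`), so `Cont(G)` is equivalent to the atomic sheaves
with no strictness assumption. Strictness of all arrows amounts to fullness of `F`
(`full_homFunctor`, `isStrictMonomorphism_of_full`), and fullness is what identifies the
representables with the sections of the `F c`. -/

namespace GaloisTopos

/-! ### Group topologies generated by subgroups. -/

section TopologicalGroups

variable {G : Type*} [Group G] {B : Set (Subgroup G)}

theorem isOpen_topologyGeneratedBy_iff (hne : B.Nonempty)
    (hinter : ∀ U ∈ B, ∀ V ∈ B, ∃ W ∈ B, W ≤ U ⊓ V) {S : Set G} :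
    @IsOpen G (topologyGeneratedBy B) S ↔ ∀ x ∈ S, ∃ U ∈ B, ∀ y ∈ U, x * y ∈ S := by
  let _ := topologyGeneratedBy B
  constructor
  · intro h
    induction h with
    | basic S hS =>
      obtain ⟨U, hU, g, rfl⟩ := hS
      refine fun x hx => ⟨U, hU, fun y hy => ?_⟩
      simpa only [Set.mem_ofPred_eq, ← mul_assoc] using U.mul_mem hx hy
    | univ =>
      obtain ⟨U, hU⟩ := hne
      exact fun x _ => ⟨U, hU, fun _ _ => trivial⟩
    | inter S T _ _ hS hT =>
      rintro x ⟨hxS, hxT⟩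
      obtain ⟨U, hU, hUS⟩ := hS x hxS
      obtain ⟨V, hV, hVT⟩ := hT x hxT
      obtain ⟨W, hW, hWUV⟩ := hinter U hU V hV
      exact ⟨W, hW, fun y hy => ⟨hUS y (hWUV hy).1, hVT y (hWUV hy).2⟩⟩
    | sUnion 𝒮 _ ih =>
      rintro x ⟨S, hS, hx⟩
      obtain ⟨U, hU, hUS⟩ := ih S hS x hx
      exact ⟨U, hU, fun y hy => ⟨S, hS, hUS y hy⟩⟩
  · intro h
    refine isOpen_iff_forall_mem_open.2 fun x hx => ?_
    obtain ⟨U, hU, hUS⟩ := h x hx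
    refine ⟨{y | x⁻¹ * y ∈ U}, fun y hy => ?_,
      TopologicalSpace.isOpen_generateFrom_of_mem ⟨U, hU, x, rfl⟩, ?_⟩
    · simpa using hUS _ hy
    · simp [U.one_mem]

theorem isAlgebraicBase_topologyGeneratedBy (hne : B.Nonempty)
    (hinter : ∀ U ∈ B, ∀ V ∈ B, ∃ W ∈ B, W ≤ U ⊓ V)
    (hconj : ∀ U ∈ B, ∀ g : G, U.map (MulAut.conj g).toMonoidHom ∈ B) :
    IsAlgebraicBase (topologyGeneratedBy B) B := by
  let _ := topologyGeneratedBy B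
  have hcoset : ∀ U ∈ B, ∀ g : G, IsOpen {x | g⁻¹ * x ∈ U} := fun U hU g =>
    TopologicalSpace.isOpen_generateFrom_of_mem ⟨U, hU, g, rfl⟩
  have hmem : ∀ (U : Subgroup G) (g x : G),
      x ∈ U.map (MulAut.conj g).toMonoidHom ↔ g⁻¹ * x * g ∈ U := by
    intro U g x
    constructor
    · rintro ⟨y, hy, rfl⟩
      simpa [mul_assoc] using hy
    · exact fun h => ⟨_, h, by simp [mul_assoc]⟩
  refine ⟨{ continuous_mul := ?_, continuous_inv := ?_ }, ⟨fun S => ?_⟩, hinter, hconj⟩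
  · refine continuous_generateFrom_iff.2 ?_
    rintro _ ⟨U, hU, g, rfl⟩
    refine isOpen_prod_iff.2 fun x y hxy => ?_
    -- The neighbourhoods are `x (y U y⁻¹)` and `y U`, since `g⁻¹x'y' = (g⁻¹xy) (y⁻¹(x⁻¹x')y)
    -- (y⁻¹y')`.
    refine ⟨_, _, hcoset _ (hconj U hU y) x, hcoset U hU y, ?_, ?_, ?_⟩
    · simp
    · simp [U.one_mem]
    · rintro ⟨x', y'⟩ ⟨hx, hy⟩
      have hx := (hmem _ _ _).1 hx
      simpa [mul_assoc] using U.mul_mem (U.mul_mem hxy hx) hy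
  · refine continuous_generateFrom_iff.2 ?_
    rintro _ ⟨U, hU, g, rfl⟩
    refine (isOpen_topologyGeneratedBy_iff hne hinter).2 fun x hx => ?_
    refine ⟨_, hconj U hU x⁻¹, fun y hy => ?_⟩
    have hy := (hmem _ _ _).1 hy
    simpa [mul_assoc] using U.mul_mem hx (U.inv_mem hy)
  · rw [mem_nhds_iff]
    constructor
    · rintro ⟨T, hTS, hT, h1⟩
      obtain ⟨U, hU, hUT⟩ := (isOpen_topologyGeneratedBy_iff hne hinter).1 hT 1 h1
      exact ⟨U, hU, fun y hy => hTS (by simpa using hUT y hy)⟩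
    · rintro ⟨U, hU, hUS⟩
      exact ⟨U, hUS, by simpa using hcoset U hU 1, U.one_mem⟩

end TopologicalGroups

/-! ### Sheaves for the atomic topology. -/

section AtomicSheaves

variable {S : Type*} [Category S]

/-- A non-empty sieve contains the sieve generated by any one of its arrows. Passing to the larger
sieve only needs separatedness for pullbacks, and the Ore condition makes each pullback contain an
arrow. -/
theorem isSheaf_atomic_iff (hro : GrothendieckTopology.RightOreCondition S)
    (P : Sᵒᵖ ⥤ Type v) :
    Presieve.IsSheaf (GrothendieckTopology.atomic hro) P ↔
      ∀ ⦃X Y : S⦄ (f : X ⟶ Y), Presieve.IsSheafFor P (Presieve.singleton f) := by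
  constructor
  · intro h X Y f
    rw [Presieve.isSheafFor_iff_generate]
    exact h _ ⟨X, f, Sieve.le_generate _ _ _ (Presieve.singleton_self f)⟩
  · rintro h Y R ⟨X, f, hf⟩
    refine Presieve.isSheafFor_subsieve_aux P
      (S := Sieve.generate (Presieve.singleton f)) ?_
      ((Presieve.isSheafFor_iff_generate _).1 (h f)) fun Z g _ => ?_
    · exact (Sieve.generate_le_iff _ _).2 fun _ _ ⟨⟩ => hf
    · obtain ⟨W, k, l, hkl⟩ := hro g f
      intro x s t hs ht
      have hk : (Sieve.generate (Presieve.singleton f)).pullback g k :=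
        ⟨X, l, f, Presieve.singleton_self f, hkl.symm⟩
      exact Presieve.isSeparatedFor_singleton.1 (h k).isSeparatedFor
        ((hs k hk).trans (ht k hk).symm)

end AtomicSheaves

section ContinuousActions

variable {G : Type v} [Group G] {τ : TopologicalSpace G}

instance : ConcreteCategory (ContSet G τ) (fun X Y => X.carrier →[G] Y.carrier) where
  hom f := f
  ofHom f := f
  id_apply _ := rfl
  comp_apply _ _ _ := rfl

end ContinuousActions

/-! ### Amalgamation, transitivity and the algebraic base. -/

section GaloisObjects

variable {C : Type v} [SmallCategory C] {D : Type w} [Category.{v} D]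

/-- `u` is a universal and ultrahomogeneous object for the full embedding `ι`, through which arrows
from objects of `C` factor jointly, and with respect to which they are monic. -/
class IsGaloisObject (ι : C ⥤ D) (u : D) : Prop where
  isUltrahomogeneous : IsUltrahomogeneous ι u
  isUniversalObject : IsUniversalObject ι u
  hasJointFactorization : HasJointFactorization ι u
  isMonicOverSource : IsMonicOverSource ι u

namespace IsGaloisObject

variable (ι : C ⥤ D) (u : D) [IsGaloisObject ι u]

theorem exists_smul_eq {c : C} (χ ψ : ι.obj c ⟶ u) : ∃ g : Aut u, g • χ = ψ := by
  obtain ⟨i, hi⟩ := isUltrahomogeneous (𝟙 c) χ ψ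
  exact ⟨i, hi.trans (by simp)⟩

variable {ι u}

theorem exists_map_comp_eq {a b : C} (f : a ⟶ b) (ξ : ι.obj a ⟶ u) :
    ∃ χ : ι.obj b ⟶ u, ι.map f ≫ χ = ξ := by
  obtain ⟨χ⟩ := isUniversalObject (ι := ι) (u := u) b
  obtain ⟨g, hg⟩ := exists_smul_eq ι u (ι.map f ≫ χ) ξ
  exact ⟨g • χ, by rw [← hg, smul_def, smul_def, Category.assoc]⟩

theorem comp_eq_comp {a b : C} {f g : a ⟶ b} (χ : ι.obj b ⟶ u)
    (h : ι.map f ≫ χ = ι.map g ≫ χ) : f = g :=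
  isMonicOverSource f g χ h

variable (ι u)

/-- The span is first completed over `u`, by extending along `g`; joint factorization brings the
square into `C`, where cancellation makes it commute. -/
theorem amalgamationProperty (ι : C ⥤ D) (u : D) [IsGaloisObject ι u] : AmalgamationProperty C := by
  intro a b c f g
  obtain ⟨χ⟩ := isUniversalObject (ι := ι) (u := u) b
  obtain ⟨ψ, hψ⟩ := exists_map_comp_eq g (ι.map f ≫ χ)
  obtain ⟨d, f', g', ε, rfl, rfl⟩ := hasJointFactorization χ ψ
  exact ⟨d, f', g', comp_eq_comp ε (by simpa using hψ.symm)⟩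

theorem jointEmbeddingProperty (ι : C ⥤ D) (u : D) [IsGaloisObject ι u] : JointEmbeddingProperty C := by
  intro a b
  obtain ⟨ξ⟩ := isUniversalObject (ι := ι) (u := u) a
  obtain ⟨χ⟩ := isUniversalObject (ι := ι) (u := u) b
  obtain ⟨c, f, g, -⟩ := hasJointFactorization ξ χ
  exact ⟨c, ⟨f⟩, ⟨g⟩⟩

theorem isTransitive_homFunctor_obj (c : Cᵒᵖ) : ((homFunctor ι u).obj c).IsTransitive :=
  ⟨isUniversalObject (ι := ι) (u := u) c.unop, ⟨exists_smul_eq ι u⟩⟩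

theorem fixers_nonempty [Nonempty C] : (fixers ι u).Nonempty := by
  obtain ⟨c⟩ := ‹Nonempty C›
  obtain ⟨χ⟩ := isUniversalObject (ι := ι) (u := u) c
  exact ⟨_, c, χ, rfl⟩

theorem exists_mem_fixers_le_inf :
    ∀ U ∈ fixers ι u, ∀ V ∈ fixers ι u, ∃ W ∈ fixers ι u, W ≤ U ⊓ V := by
  rintro _ ⟨a, ξ, rfl⟩ _ ⟨b, χ, rfl⟩
  obtain ⟨c, f, g, ε, rfl, rfl⟩ := hasJointFactorization ξ χ
  refine ⟨_, ⟨c, ε, rfl⟩, fun i (hi : ε ≫ i.hom = ε) => ⟨?_, ?_⟩⟩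
  · change (ι.map f ≫ ε) ≫ i.hom = ι.map f ≫ ε
    rw [Category.assoc, hi]
  · change (ι.map g ≫ ε) ≫ i.hom = ι.map g ≫ ε
    rw [Category.assoc, hi]

theorem isAlgebraicBase_fixers [Nonempty C] :
    IsAlgebraicBase (autTopology ι u) (fixers ι u) := by
  refine isAlgebraicBase_topologyGeneratedBy (fixers_nonempty ι u)
    (exists_mem_fixers_le_inf ι u) ?_
  rintro _ ⟨c, χ, rfl⟩ g
  refine ⟨c, g • χ, ?_⟩
  ext i
  change _ ↔ i • g • χ = g • χ
  constructor
  · rintro ⟨j, hj : j • χ = χ, rfl⟩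
    simp [smul_smul, mul_smul, hj]
  · intro hi
    refine ⟨g⁻¹ * i * g, ?_, by simp [mul_assoc]⟩
    change (g⁻¹ * i * g) • χ = χ
    rw [mul_smul, mul_smul, hi, inv_smul_smul]

end IsGaloisObject

end GaloisObjects

/-! ### Equivariant maps out of `Hom(c, u)`, and fullness of `F`. -/

section GaloisObjects

variable {C : Type v} [SmallCategory C] {D : Type w} [Category.{v} D]

theorem ContSet.map_smul {G : Type v} [Group G] {τ : TopologicalSpace G} {X Y : ContSet G τ}
    (φ : X ⟶ Y) (g : G) (x : X.carrier) : φ (g • x) = g • φ x :=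
  MulActionHom.map_smul (φ : X.carrier →[G] Y.carrier) g x

theorem homFunctor_map_smul {ι : C ⥤ D} {u : D} {c : C} {X : ContSet (Aut u) (autTopology ι u)}
    (φ : (homFunctor ι u).obj (op c) ⟶ X) (g : Aut u) (χ : ι.obj c ⟶ u) :
    φ (g • χ) = g • φ χ :=
  ContSet.map_smul φ g χ

theorem map_comp_smul {ι : C ⥤ D} {u : D} {a b : C} (f : a ⟶ b) (g : Aut u) (χ : ι.obj b ⟶ u) :
    ι.map f ≫ (g • χ) = g • (ι.map f ≫ χ) :=
  (Category.assoc _ _ _).symm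

namespace IsGaloisObject

variable {ι : C ⥤ D} {u : D} [IsGaloisObject ι u]

theorem hom_ext_of_apply_eq {c : C} {X : ContSet (Aut u) (autTopology ι u)}
    {φ ψ : (homFunctor ι u).obj (op c) ⟶ X} (χ : ι.obj c ⟶ u) (h : φ χ = ψ χ) : φ = ψ := by
  refine ConcreteCategory.hom_ext _ _ fun (ξ : ι.obj c ⟶ u) => ?_
  obtain ⟨g, rfl⟩ := exists_smul_eq ι u χ ξ
  rw [homFunctor_map_smul, homFunctor_map_smul, h]

/-- `Hom(c, u)` is the orbit of `χ`, so `g • χ ↦ g • x` is defined everywhere, and well defined by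
`h`. -/
theorem exists_hom_apply_eq {c : C} {X : ContSet (Aut u) (autTopology ι u)} (χ : ι.obj c ⟶ u)
    (x : X.carrier) (h : ∀ g ∈ fixer χ, g • x = x) :
    ∃ φ : (homFunctor ι u).obj (op c) ⟶ X, φ χ = x := by
  choose σ hσ using exists_smul_eq ι u χ
  have key : ∀ g g' : Aut u, g • χ = g' • χ → g • x = g' • x := fun g g' hg => by
    rw [← inv_smul_eq_iff, smul_smul]
    refine h _ (?_ : (g'⁻¹ * g) • χ = χ)
    rw [mul_smul, hg, inv_smul_smul]
  refine ⟨ConcreteCategory.ofHom (C := ContSet _ _)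
    { toFun := fun ψ => σ ψ • x, map_smul' := fun g (ψ : ι.obj c ⟶ u) => ?_ }, ?_⟩
  · rw [id, smul_smul]
    exact key _ _ ((hσ (g • ψ)).trans (by rw [mul_smul, hσ]))
  · exact (key _ 1 (by rw [hσ, one_smul])).trans (one_smul _ _)

theorem exists_fixer_le_stabilizer [Nonempty C] (X : ContSet (Aut u) (autTopology ι u))
    (x : X.carrier) : ∃ (c : C) (χ : ι.obj c ⟶ u), ∀ g ∈ fixer χ, g • x = x := by
  let _ := autTopology ι u
  let _ : TopologicalSpace X.carrier := ⊥
  have _ : DiscreteTopology X.carrier := ⟨rfl⟩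
  have _ := X.continuous_action
  have h : {g : Aut u | g • x = x} ∈ nhds (1 : Aut u) :=
    ((isOpen_discrete {x}).preimage (continuous_id.smul continuous_const)).mem_nhds
      (one_smul _ x)
  obtain ⟨_, ⟨c, χ, rfl⟩, hU⟩ := (isAlgebraicBase_fixers ι u).hasBasis.mem_iff.1 h
  exact ⟨c, χ, hU⟩

theorem exists_hom_apply_eq' [Nonempty C] (X : ContSet (Aut u) (autTopology ι u))
    (x : X.carrier) :
    ∃ (c : C) (χ : ι.obj c ⟶ u) (φ : (homFunctor ι u).obj (op c) ⟶ X), φ χ = x := by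
  obtain ⟨c, χ, h⟩ := exists_fixer_le_stabilizer X x
  exact ⟨c, χ, exists_hom_apply_eq χ x h⟩

theorem continuousSMul_of_fixer_le_stabilizer [Nonempty C] {X : Type*} [MulAction (Aut u) X]
    (h : ∀ x : X, ∃ (c : C) (χ : ι.obj c ⟶ u), ∀ g ∈ fixer χ, g • x = x) :
    @ContinuousSMul (Aut u) X _ (autTopology ι u) ⊥ := by
  let _ := autTopology ι u
  let _ : TopologicalSpace X := ⊥
  have _ : DiscreteTopology X := ⟨rfl⟩
  refine ⟨continuous_prod_of_discrete_right.2 fun x => continuous_discrete_rng.2 fun y => ?_⟩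
  refine (isOpen_topologyGeneratedBy_iff (fixers_nonempty ι u)
    (exists_mem_fixers_le_inf ι u)).2 fun g hg => ?_
  obtain ⟨c, χ, hχ⟩ := h x
  refine ⟨_, ⟨c, χ, rfl⟩, fun k hk => ?_⟩
  change (g * k) • x = y
  rw [mul_smul, hχ k hk]
  exact hg

theorem exists_smul_eq_map_comp {a b c : C} {m : a ⟶ b} {h k : b ⟶ c} (hm : m ≫ h = m ≫ k)
    (ε : ι.obj b ⟶ u) (δ : ι.obj c ⟶ u) :
    ∃ i j : Aut u, i • ε = ι.map h ≫ δ ∧ j • ε = ι.map k ≫ δ ∧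
      i • (ι.map m ≫ ε) = j • (ι.map m ≫ ε) := by
  obtain ⟨i, hi⟩ := exists_smul_eq ι u ε (ι.map h ≫ δ)
  obtain ⟨j, hj⟩ := exists_smul_eq ι u ε (ι.map k ≫ δ)
  refine ⟨i, j, hi, hj, ?_⟩
  rw [← map_comp_smul, ← map_comp_smul, hi, hj, ← Category.assoc, ← Category.assoc,
    ← ι.map_comp, ← ι.map_comp, hm]

theorem exists_comp_eq_of_map_comp_eq {d c : C} (f : d ⟶ c) {χ χ' : ι.obj c ⟶ u}
    (h : ι.map f ≫ χ = ι.map f ≫ χ') :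
    ∃ (z : C) (p q : c ⟶ z) (ε : ι.obj z ⟶ u),
      ι.map p ≫ ε = χ ∧ ι.map q ≫ ε = χ' ∧ f ≫ p = f ≫ q := by
  obtain ⟨z, p, q, ε, rfl, rfl⟩ := hasJointFactorization χ χ'
  exact ⟨z, p, q, ε, rfl, rfl, comp_eq_comp ε (by simpa using h)⟩

/-- The functors `Hom(-, u)` turn arrows of `C` into quotient maps: an equivariant map out of
`Hom(c, u)` that coequalizes the pairs coequalized by `- ∘ f` descends along `- ∘ f`. -/
theorem existsUnique_map_comp_eq {d c : C} (f : d ⟶ c)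
    {X : ContSet (Aut u) (autTopology ι u)} (s : (homFunctor ι u).obj (op c) ⟶ X)
    (hs : ∀ ⦃z : C⦄ (p q : c ⟶ z), f ≫ p = f ≫ q →
      (homFunctor ι u).map p.op ≫ s = (homFunctor ι u).map q.op ≫ s) :
    ∃! t : (homFunctor ι u).obj (op d) ⟶ X, (homFunctor ι u).map f.op ≫ t = s := by
  obtain ⟨χ⟩ := isUniversalObject (ι := ι) (u := u) c
  -- If `g` fixes `χ ∘ f`, then `g • χ` and `χ` agree along `f`, so they come from a pair `p, q`
  -- coequalized by `f`, to which `hs` applies.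
  have h : ∀ g ∈ fixer (ι.map f ≫ χ), g • s χ = s χ := fun g (hg : g • (ι.map f ≫ χ) = _) => by
    rw [← map_comp_smul] at hg
    obtain ⟨z, p, q, ε, hp, hq, hpq⟩ := exists_comp_eq_of_map_comp_eq f hg
    rw [← homFunctor_map_smul, ← hp, ← hq]
    exact ConcreteCategory.congr_hom (hs p q hpq) ε
  obtain ⟨t, ht⟩ := exists_hom_apply_eq (ι.map f ≫ χ) (s χ) h
  refine ⟨t, hom_ext_of_apply_eq χ ht, fun t' ht' => hom_ext_of_apply_eq (ι.map f ≫ χ) ?_⟩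
  rw [ht, ← ht']
  rfl

variable (ι u)

instance faithful_homFunctor : (homFunctor ι u).Faithful where
  map_injective {c d f g} h := by
    obtain ⟨χ⟩ := isUniversalObject (ι := ι) (u := u) c.unop
    exact Quiver.Hom.unop_inj (comp_eq_comp χ (ConcreteCategory.congr_hom h χ))

theorem full_homFunctor (hC : ∀ ⦃d c : C⦄ (f : d ⟶ c), IsStrictMonomorphism f) :
    (homFunctor ι u).Full where
  map_surjective {c d} φ := by
    obtain ⟨χ⟩ := isUniversalObject (ι := ι) (u := u) c.unop
    let ξ : ι.obj d.unop ⟶ u := φ χ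
    obtain ⟨e, m, n, ε, hm, hn⟩ := hasJointFactorization χ ξ
    -- Arrows `h, k` that agree on `m` are realized by automorphisms `i, j` of `u` that agree on
    -- `χ`, hence on `ξ = φ χ` by equivariance; so `h, k` agree on `n`.
    obtain ⟨l, hl, -⟩ := hC m n fun z h k hmk => by
      obtain ⟨δ⟩ := isUniversalObject (ι := ι) (u := u) z
      obtain ⟨i, j, hi, hj, hij⟩ := exists_smul_eq_map_comp hmk ε δ
      rw [hm] at hij
      have hξ : i • ξ = j • ξ := (homFunctor_map_smul φ i χ).symm.trans
        ((congrArg φ hij).trans (homFunctor_map_smul φ j χ))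
      rw [← hn, ← map_comp_smul, ← map_comp_smul, hi, hj] at hξ
      exact comp_eq_comp δ (by simpa using hξ)
    refine ⟨l.op, hom_ext_of_apply_eq χ (?_ : ι.map l ≫ χ = ξ)⟩
    rw [← hn, ← hl, ι.map_comp, Category.assoc, hm]

/-- The condition on `g` lets `F g` descend along the quotient map `F f`; fullness lifts the
descended map to `C`. -/
theorem isStrictMonomorphism_of_full [(homFunctor ι u).Full] {d c : C} (f : d ⟶ c) :
    IsStrictMonomorphism f := by
  intro e g hg
  obtain ⟨t, ht, ht'⟩ := existsUnique_map_comp_eq f ((homFunctor ι u).map g.op)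
    fun z p q hpq => by
      rw [← Functor.map_comp, ← Functor.map_comp, ← op_comp, ← op_comp, hg p q hpq]
  obtain ⟨l, rfl⟩ := (homFunctor ι u).map_surjective t
  refine ⟨l.unop, ?_, fun l' hl' => ?_⟩
  · exact Quiver.Hom.op_inj ((homFunctor ι u).map_injective (by simpa using ht))
  · refine Quiver.Hom.op_inj ((homFunctor ι u).map_injective (ht' _ ?_))
    dsimp only
    rw [← Functor.map_comp, ← op_comp, hl']

end IsGaloisObject

end GaloisObjects

/-! ### Sections of a continuous action, as an atomic sheaf. -/

section Sections

variable {C : Type v} [SmallCategory C] {D : Type w} [Category.{v} D]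

open IsGaloisObject

/-- The presheaf on `Cᵒᵖ` of equivariant maps from the actions `Hom(-, u)` to a continuous
action of `Aut u`. -/
abbrev sectionsPresheaf (ι : C ⥤ D) (u : D) :
    ContSet (Aut u) (autTopology ι u) ⥤ Cᵒᵖᵒᵖ ⥤ Type v :=
  yoneda ⋙ (Functor.whiskeringLeft _ _ _).obj (homFunctor ι u).op

variable (ι : C ⥤ D) (u : D) [IsGaloisObject ι u]

theorem isSheaf_sectionsPresheaf (hAP : AmalgamationProperty C)
    (X : ContSet (Aut u) (autTopology ι u)) :
    Presheaf.IsSheaf (atomicTopology hAP) ((sectionsPresheaf ι u).obj X) := by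
  rw [isSheaf_iff_isSheaf_of_type, atomicTopology, isSheaf_atomic_iff]
  intro c d f
  rw [Presieve.isSheafFor_singleton]
  exact fun s hs => existsUnique_map_comp_eq f.unop s fun z p q hpq =>
    hs p.op q.op (Quiver.Hom.unop_inj hpq)

/-- The functor from continuous actions of `Aut u` to atomic sheaves on `Cᵒᵖ` that sends `X` to
the sheaf of equivariant maps from the actions `Hom(-, u)` to `X`. -/
abbrev sectionsSheaf (hAP : AmalgamationProperty C) :
    ContSet (Aut u) (autTopology ι u) ⥤ Sheaf (atomicTopology hAP) (Type v) :=
  ObjectProperty.lift _ (sectionsPresheaf ι u) (isSheaf_sectionsPresheaf ι u hAP)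

instance faithful_sectionsPresheaf [Nonempty C] : (sectionsPresheaf ι u).Faithful where
  map_injective {X Y α β} h := by
    refine ConcreteCategory.hom_ext _ _ fun x => ?_
    obtain ⟨c, χ, φ, rfl⟩ := exists_hom_apply_eq' X x
    have := ConcreteCategory.congr_hom (NatTrans.congr_app h (op (op c))) φ
    exact ConcreteCategory.congr_hom (this : φ ≫ α = φ ≫ β) χ

instance full_sectionsPresheaf [Nonempty C] : (sectionsPresheaf ι u).Full where
  map_surjective {X Y} η := by
    let α {c : C} (φ : (homFunctor ι u).obj (op c) ⟶ X) : (homFunctor ι u).obj (op c) ⟶ Y :=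
      (η.app (op (op c))).hom φ
    have hα {b c : C} (f : b ⟶ c) (φ : (homFunctor ι u).obj (op b) ⟶ X) :
        α ((homFunctor ι u).map f.op ≫ φ) = (homFunctor ι u).map f.op ≫ α φ :=
      ConcreteCategory.congr_hom (η.naturality f.op.op) φ
    -- Each point of `X` is a value `φ χ`; this makes `φ χ ↦ α φ χ` independent of the presentation.
    have key : ∀ {b c : C} (χ : ι.obj b ⟶ u) (ψ : ι.obj c ⟶ u)
        (φ : (homFunctor ι u).obj (op b) ⟶ X) (φ' : (homFunctor ι u).obj (op c) ⟶ X),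
        φ χ = φ' ψ → α φ χ = α φ' ψ := by
      intro b c χ ψ φ φ' h
      obtain ⟨e, f, g, ε, rfl, rfl⟩ := hasJointFactorization χ ψ
      have : (homFunctor ι u).map f.op ≫ φ = (homFunctor ι u).map g.op ≫ φ' :=
        hom_ext_of_apply_eq ε h
      have := congrArg α this
      rw [hα, hα] at this
      exact ConcreteCategory.congr_hom this ε
    choose c χ φ hφ using exists_hom_apply_eq' (ι := ι) X
    refine ⟨ConcreteCategory.ofHom (C := ContSet _ _)
      { toFun := fun x => α (φ x) (χ x), map_smul' := fun g x => ?_ }, ?_⟩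
    · rw [id, ← homFunctor_map_smul (α (φ x))]
      exact key _ _ _ _ (by rw [hφ, homFunctor_map_smul, hφ])
    · ext ⟨⟨b⟩⟩ ψ
      refine ConcreteCategory.hom_ext _ _ fun ξ => ?_
      exact key _ _ _ _ (hφ _)

end Sections

/-! ### The stalk at `u`, inverse to taking sections. -/

section Stalk

variable {C : Type v} [SmallCategory C] {D : Type w} [Category.{v} D]

open IsGaloisObject

variable (ι : C ⥤ D) (u : D) [IsGaloisObject ι u] (P : Cᵒᵖᵒᵖ ⥤ Type v)

/-- Two sections of `P` at arrows to `u` have the same germ if they become equal along a joint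
factorization of these arrows. -/
def stalkSetoid : Setoid (Σ c : C, (ι.obj c ⟶ u) × P.obj (op (op c))) where
  r s t := ∃ (e : C) (f : s.1 ⟶ e) (g : t.1 ⟶ e) (ε : ι.obj e ⟶ u),
    ι.map f ≫ ε = s.2.1 ∧ ι.map g ≫ ε = t.2.1 ∧
      P.map f.op.op s.2.2 = P.map g.op.op t.2.2
  iseqv := by
    refine ⟨fun s => ⟨s.1, 𝟙 _, 𝟙 _, s.2.1, by simp, by simp, rfl⟩, ?_, ?_⟩
    · rintro s t ⟨e, f, g, ε, hf, hg, h⟩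
      exact ⟨e, g, f, ε, hg, hf, h.symm⟩
    · rintro ⟨a, χ, p⟩ ⟨b, ψ, q⟩ ⟨c, ω, r⟩ ⟨e, f, g, ε, hf, hg, h⟩ ⟨e', f', g', ε', hf', hg', h'⟩
      dsimp only at *
      obtain ⟨z, m, m', δ, rfl, rfl⟩ := hasJointFactorization ε ε'
      have hm : g ≫ m = f' ≫ m' := comp_eq_comp δ (by simp [hg, hf'])
      refine ⟨z, f ≫ m, g' ≫ m', δ, by simpa using hf, by simpa using hg', ?_⟩
      calc P.map (f ≫ m).op.op p = P.map m.op.op (P.map f.op.op p) := by simp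
        _ = P.map (g ≫ m).op.op q := by rw [h]; simp
        _ = P.map m'.op.op (P.map f'.op.op q) := by rw [hm]; simp
        _ = P.map (g' ≫ m').op.op r := by rw [h']; simp

/-- The filtered colimit of the values of `P` along the arrows from objects of `C` to `u`. -/
def Stalk : Type v := Quotient (stalkSetoid ι u P)

namespace Stalk

variable {ι u P}

/-- The germ of a section of `P` along an arrow to `u`. -/
def germ {c : C} (χ : ι.obj c ⟶ u) (p : P.obj (op (op c))) : Stalk ι u P :=
  Quotient.mk (stalkSetoid ι u P) ⟨c, χ, p⟩

theorem germ_eq_germ_iff {b c : C} {χ : ι.obj b ⟶ u} {p : P.obj (op (op b))} {ψ : ι.obj c ⟶ u}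
    {q : P.obj (op (op c))} :
    germ χ p = germ ψ q ↔ ∃ (e : C) (f : b ⟶ e) (g : c ⟶ e) (ε : ι.obj e ⟶ u),
      ι.map f ≫ ε = χ ∧ ι.map g ≫ ε = ψ ∧ P.map f.op.op p = P.map g.op.op q :=
  Quotient.eq (r := stalkSetoid ι u P)

theorem exists_germ_eq (x : Stalk ι u P) :
    ∃ (c : C) (χ : ι.obj c ⟶ u) (p : P.obj (op (op c))), germ χ p = x := by
  obtain ⟨⟨c, χ, p⟩, rfl⟩ := Quotient.exists_rep x
  exact ⟨c, χ, p, rfl⟩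

theorem germ_map {b c : C} (f : b ⟶ c) (χ : ι.obj c ⟶ u) (p : P.obj (op (op b))) :
    germ χ (P.map f.op.op p) = germ (ι.map f ≫ χ) p :=
  germ_eq_germ_iff.2 ⟨c, 𝟙 c, f, χ, by simp, rfl, by simp⟩

instance : MulAction (Aut u) (Stalk ι u P) where
  smul g := Quotient.map (fun s => ⟨s.1, g • s.2.1, s.2.2⟩) (by
    rintro s t ⟨e, f, h, ε, hf, hh, hp⟩
    exact ⟨e, f, h, g • ε, by rw [map_comp_smul, hf], by rw [map_comp_smul, hh], hp⟩)
  one_smul x := by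
    obtain ⟨c, χ, p, rfl⟩ := exists_germ_eq x
    exact congrArg (germ · p) (one_smul (Aut u) χ)
  mul_smul g h x := by
    obtain ⟨c, χ, p, rfl⟩ := exists_germ_eq x
    exact congrArg (germ · p) (mul_smul g h χ)

theorem smul_germ (g : Aut u) {c : C} (χ : ι.obj c ⟶ u) (p : P.obj (op (op c))) :
    g • germ χ p = germ (g • χ) p := rfl

theorem germ_injective
    (hP : ∀ ⦃c d : Cᵒᵖ⦄ (f : c ⟶ d), Presieve.IsSheafFor P (Presieve.singleton f))
    {c : C} (χ : ι.obj c ⟶ u) :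
    Function.Injective (germ (P := P) χ) := by
  intro p q h
  obtain ⟨e, f, g, ε, hf, hg, hpq⟩ := germ_eq_germ_iff.1 h
  obtain rfl : f = g := comp_eq_comp ε (hf.trans hg.symm)
  exact Presieve.isSeparatedFor_singleton.1 (hP f.op).isSeparatedFor hpq

variable (ι u P) in
/-- The stalk of `P` as a continuous action of `Aut u`. -/
def contSet [Nonempty C] : ContSet (Aut u) (autTopology ι u) where
  carrier := Stalk ι u P
  continuous_action := continuousSMul_of_fixer_le_stabilizer fun x => by
    obtain ⟨c, χ, p, rfl⟩ := exists_germ_eq x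
    exact ⟨c, χ, fun g hg => congrArg (germ · p) hg⟩

variable [Nonempty C]

/-- A section of `P` as an equivariant map to the stalk. -/
def ofSection {c : C} (p : P.obj (op (op c))) : (homFunctor ι u).obj (op c) ⟶ contSet ι u P :=
  ConcreteCategory.ofHom (C := ContSet _ _)
    { toFun := fun χ : ι.obj c ⟶ u => germ χ p
      map_smul' := fun _ _ => rfl }

theorem ofSection_apply {c : C} (p : P.obj (op (op c))) (χ : ι.obj c ⟶ u) :
    ofSection p χ = germ χ p := rfl

variable (ι u P) in
/-- The canonical map from `P` to the sections of its stalk. -/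
def toSections : P ⟶ (sectionsPresheaf ι u).obj (contSet ι u P) where
  app c := TypeCat.ofHom fun p => ofSection (c := c.unop.unop) p
  naturality b c f := by
    ext p
    exact hom_ext_of_apply_eq (isUniversalObject (ι := ι) (u := u) _).some
      (germ_map f.unop.unop _ p)

theorem exists_ofSection_eq
    (hP : ∀ ⦃c d : Cᵒᵖ⦄ (f : c ⟶ d), Presieve.IsSheafFor P (Presieve.singleton f))
    {c : C} (φ : (homFunctor ι u).obj (op c) ⟶ contSet ι u P) :
    ∃ p : P.obj (op (op c)), ofSection p = φ := by
  obtain ⟨χ⟩ := isUniversalObject (ι := ι) (u := u) c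
  obtain ⟨d, ξ, q, hq⟩ := exists_germ_eq (φ χ)
  obtain ⟨e, m, n, ε, hm, hn⟩ := hasJointFactorization χ ξ
  -- Over `e` the value `φ χ` is the germ at `ε` of the restriction of `q` along `n`. It descends
  -- along `m`: its two restrictions have equal germs by equivariance of `φ`, and `germ_injective`
  -- applies.
  obtain ⟨p, hp, -⟩ := Presieve.isSheafFor_singleton.1 (hP m.op) (P.map n.op.op q)
    fun {z} h k hhk => by
      obtain ⟨δ⟩ := isUniversalObject (ι := ι) (u := u) z.unop
      obtain ⟨i, j, hi, hj, hij⟩ :=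
        exists_smul_eq_map_comp (Quiver.Hom.op_inj hhk : m ≫ h.unop = m ≫ k.unop) ε δ
      refine germ_injective hP δ ?_
      have hs : ∀ g : Aut u, g • germ ε (P.map n.op.op q) = φ (g • χ) := fun g => by
        rw [germ_map, hn, hq, homFunctor_map_smul]
        rfl
      rw [hm] at hij
      change germ δ (P.map h.unop.op.op _) = germ δ (P.map k.unop.op.op _)
      rw [germ_map h.unop, germ_map k.unop, ← hi, ← hj, ← smul_germ, ← smul_germ, hs, hs, hij]
  refine ⟨p, hom_ext_of_apply_eq χ ?_⟩
  rw [ofSection_apply, ← hq, ← hm, ← germ_map, hp, germ_map, hn]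

theorem isIso_toSections
    (hP : ∀ ⦃c d : Cᵒᵖ⦄ (f : c ⟶ d), Presieve.IsSheafFor P (Presieve.singleton f)) :
    IsIso (toSections ι u P) := by
  rw [NatTrans.isIso_iff_isIso_app]
  intro c
  rw [isIso_iff_bijective]
  refine ⟨fun p q h => ?_, exists_ofSection_eq hP⟩
  obtain ⟨χ⟩ := isUniversalObject (ι := ι) (u := u) c.unop.unop
  exact germ_injective hP χ (ConcreteCategory.congr_hom h χ)

end Stalk

end Stalk

/-! ### The equivalence with atomic sheaves. -/

section Equivalence

variable {C : Type v} [SmallCategory C] [Nonempty C] {D : Type w} [Category.{v} D]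
variable (ι : C ⥤ D) (u : D) [IsGaloisObject ι u] (hAP : AmalgamationProperty C)

instance isEquivalence_sectionsSheaf : (sectionsSheaf ι u hAP).IsEquivalence where
  faithful := inferInstance
  full := inferInstance
  essSurj.mem_essImage P := by
    have := Stalk.isIso_toSections (ι := ι) (u := u) ((isSheaf_atomic_iff hAP.rightOre _).1
      ((isSheaf_iff_isSheaf_of_type _ _).1 P.property))
    exact ⟨Stalk.contSet ι u P.obj,
      ⟨(fullyFaithfulSheafToPresheaf _ _).preimageIso (asIso (Stalk.toSections ι u P.obj)).symm⟩⟩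

theorem inducesEquivalence_homFunctor [(homFunctor ι u).Full] :
    InducesEquivalence (atomicTopology hAP) (homFunctor ι u) := by
  let Ψ := (sectionsSheaf ι u hAP).asEquivalence
  -- Full faithfulness gives `Hom(d, c) ≃ Hom(F d, F c)`. Representables are thus already sheaves,
  -- so the sheafification counit removes the associated sheaf functor below.
  let e : yoneda ≅ homFunctor ι u ⋙ sectionsPresheaf ι u :=
    NatIso.ofComponents fun c => NatIso.ofComponents fun d =>
      ((Functor.FullyFaithful.ofFullyFaithful (homFunctor ι u)).homEquiv
        (X := d.unop) (Y := c)).toIso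
  refine ⟨Ψ.symm, ⟨?_⟩⟩
  exact Functor.isoWhiskerRight
      (Functor.isoWhiskerRight e _ ≪≫
        Functor.isoWhiskerLeft (homFunctor ι u ⋙ sectionsSheaf ι u hAP)
          (asIso (sheafificationAdjunction (atomicTopology hAP) (Type v)).counit)) Ψ.inverse ≪≫
    Functor.isoWhiskerLeft (homFunctor ι u) Ψ.unitIso.symm

end Equivalence

end GaloisTopos

theorem theorem4p3 {C : Type v} [SmallCategory C] [Nonempty C] {D : Type w} [Category.{v} D]
    (ι : C ⥤ D) [ι.Full] [ι.Faithful] (u : D)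
    (hultra : GaloisTopos.IsUltrahomogeneous ι u)
    (huniv : GaloisTopos.IsUniversalObject ι u)
    (ha : GaloisTopos.HasJointFactorization ι u)
    (hb : GaloisTopos.IsMonicOverSource ι u) :
    ∃ hAP : GaloisTopos.AmalgamationProperty C,
      GaloisTopos.JointEmbeddingProperty C ∧
      GaloisTopos.IsAlgebraicBase (GaloisTopos.autTopology ι u) (GaloisTopos.fixers ι u) ∧
      (∀ c : Cᵒᵖ, ((GaloisTopos.homFunctor ι u).obj c).IsTransitive) ∧
      ((∀ ⦃d c : C⦄ (f : d ⟶ c), GaloisTopos.IsStrictMonomorphism f) ↔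
        ((GaloisTopos.homFunctor ι u).Full ∧ (GaloisTopos.homFunctor ι u).Faithful ∧
          GaloisTopos.InducesEquivalence (GaloisTopos.atomicTopology hAP)
            (GaloisTopos.homFunctor ι u))) := by
  have : GaloisTopos.IsGaloisObject ι u := ⟨hultra, huniv, ha, hb⟩
  refine ⟨GaloisTopos.IsGaloisObject.amalgamationProperty ι u,
    GaloisTopos.IsGaloisObject.jointEmbeddingProperty ι u,
    GaloisTopos.IsGaloisObject.isAlgebraicBase_fixers ι u,
    GaloisTopos.IsGaloisObject.isTransitive_homFunctor_obj ι u, fun h => ?_, fun h _ _ f => ?_⟩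
  · have := GaloisTopos.IsGaloisObject.full_homFunctor ι u h
    exact ⟨this, inferInstance, GaloisTopos.inducesEquivalence_homFunctor ι u _⟩
  · have := h.1
    exact GaloisTopos.IsGaloisObject.isStrictMonomorphism_of_full ι u f
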